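/- Let $q$ be a prime power, let $n \ge 2$, and let $\mathrm{PG}(n,q)$ be the $n$-dimensional projective space over the field $\mathbb{F}_q$. A blocking set of $\mathrm{PG}(n,q)$ is a set $B$ of points such that every hyperplane contains at least one point of $B$; a hyperplane is tangent to $B$ if it contains exactly one point of $B$; a point of $B$ is essential if it lies on at least one hyperplane tangent to $B$. Let $a$ be an integer and let $B$ be a blocking set of $\mathrm{PG}(n,q)$ with $|B| = q+a+1 \le 2q$. Then every essential point of $B$ lies on at least $q^{n-1} - a\,q^{n-2}$ hyperplanes tangent to $B$. -/

import Mathlib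

open scoped LinearAlgebra.Projectivization

/-- The set of points of the `n`-dimensional projective space `PG(n, q)` over the field `K` with
`q` elements. -/
abbrev PG (n : ℕ) (K : Type*) [Field K] : Type _ := ℙ K (Fin (n + 1) → K)

namespace PG

variable {n : ℕ} {K : Type*} [Field K]

/-- A hyperplane of `PG(n, q)`: a projective subspace of projective dimension `n - 1`, that is, one
whose underlying vector subspace of the `(n + 1)`-dimensional vector space has dimension `n`. -/
def IsHyperplane (H : Projectivization.Subspace K (Fin (n + 1) → K)) : Prop :=
  Module.finrank K (Projectivization.Subspace.submodule H) = n

/-- A blocking set: a set of points such that every hyperplane contains at least one of them. -/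
def IsBlockingSet (B : Set (PG n K)) : Prop :=
  ∀ H : Projectivization.Subspace K (Fin (n + 1) → K), IsHyperplane H → ∃ P ∈ B, P ∈ H

/-- A tangent hyperplane to `B`: a hyperplane containing exactly one point of `B`. -/
def IsTangentHyperplane (B : Set (PG n K))
    (H : Projectivization.Subspace K (Fin (n + 1) → K)) : Prop :=
  IsHyperplane H ∧ ∃! P : PG n K, P ∈ B ∧ P ∈ H

/-- An essential point of `B`: a point of `B` lying on some tangent hyperplane to `B`. -/
def IsEssential (B : Set (PG n K)) (P : PG n K) : Prop :=
  P ∈ B ∧ ∃ H, IsTangentHyperplane B H ∧ P ∈ H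

end PG

/-! Let `h` cut out a tangent hyperplane at `P`, and let `Q` be another point of `B`. Adding to `h`
the forms vanishing at `Q` gives distinct hyperplanes missing `Q`, with coordinates `u` chosen so
that `P` lies on one exactly when `u 0 = 0`. Let `f u` be the product of the values of the form at
the points of `B` other than `P` and `Q`. Tangency of `h` gives `f 0 ≠ 0`, blocking makes `f` vanish
where `u 0 ≠ 0`, and nonzeros with `u 0 = 0` are tangent hyperplanes at `P`. Summing `f` over its
zeroth variable changes no value on `u 0 = 0` but lowers the degree by `q - 1`, to at most `|B| - 2
- (q - 1) = a`. Schwartz–Zippel then bounds the zeros. -/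

open MvPolynomial in
/-- A polynomial over a finite field that vanishes wherever the zeroth coordinate is nonzero, but
not at the origin, is nonzero at many points of the coordinate hyperplane. -/
theorem MvPolynomial.card_pow_le_of_eval_eq_zero {K : Type*} [Field K] [Fintype K] [DecidableEq K]
    {m : ℕ} (f : MvPolynomial (Fin (m + 1)) K)
    (h0 : eval 0 f ≠ 0) (hf : ∀ u : Fin (m + 1) → K, u 0 ≠ 0 → eval u f = 0) :
    Fintype.card K ^ (m + 1) + (Fintype.card K - 1) * Fintype.card K ^ m ≤
      Finset.card {v : Fin m → K | eval (Fin.cons 0 v : Fin (m + 1) → K) f ≠ 0} * Fintype.card K +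
        f.totalDegree * Fintype.card K ^ m := by
  set q := Fintype.card K with hq
  have hqpos : 0 < q := Fintype.card_pos
  set p := finSuccEquiv K m f with hp
  -- This is `f` summed over its zeroth variable; the power sums with `j < q - 1` vanish, which is
  -- where the degree drops.
  let g : MvPolynomial (Fin m) K :=
    ∑ j ∈ Finset.range (p.natDegree + 1), C (∑ x : K, x ^ j) * p.coeff j
  have hg (v : Fin m → K) : eval v g = eval (Fin.cons 0 v : Fin (m + 1) → K) f := by
    have h1 : ∑ x : K, eval (Fin.cons x v : Fin (m + 1) → K) f =
        eval (Fin.cons 0 v : Fin (m + 1) → K) f :=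
      Finset.sum_eq_single 0 (fun x _ hx ↦ hf _ (by simpa using hx)) (by simp)
    rw [← h1]
    simp only [eval_eq_eval_mv_eval', Polynomial.eval_map, Polynomial.eval₂_eq_sum_range, g,
      map_sum, map_mul, eval_C, ← hp]
    rw [Finset.sum_comm]
    simp_rw [← Finset.mul_sum, mul_comm]
  have hg0 : g ≠ 0 := by
    intro h
    apply h0
    have h2 := hg 0
    rwa [h, map_zero, show (Fin.cons 0 (0 : Fin m → K) : Fin (m + 1) → K) = 0 by
      ext i; refine Fin.cases ?_ (fun _ ↦ ?_) i <;> simp, eq_comm] at h2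
  have hdeg (j : ℕ) (hj : C (∑ x : K, x ^ j) * p.coeff j ≠ 0) :
      q - 1 ≤ j ∧ (C (∑ x : K, x ^ j) * p.coeff j).totalDegree + j ≤ f.totalDegree := by
    constructor
    · by_contra! h
      simp [FiniteField.sum_pow_lt_card_sub_one K j h] at hj
    · have h1 := totalDegree_coeff_finSuccEquiv_add_le f j (right_ne_zero_of_mul hj)
      have h2 := totalDegree_mul (C (∑ x : K, x ^ j)) (p.coeff j)
      rw [totalDegree_C] at h2
      rw [← hp] at h1
      omega
  have hgdeg : g.totalDegree + (q - 1) ≤ f.totalDegree := by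
    obtain ⟨j, -, hj⟩ := Finset.exists_ne_zero_of_sum_ne_zero hg0
    have h1 := hdeg j hj
    have h2 : g.totalDegree ≤ f.totalDegree - (q - 1) := by
      refine totalDegree_finsetSum_le fun i _ ↦ ?_
      by_cases hi : C (∑ x : K, x ^ i) * p.coeff i = 0
      · rw [hi, totalDegree_zero]
        exact Nat.zero_le _
      · have := hdeg i hi
        omega
    omega
  have hsz := schwartz_zippel_totalDegree hg0 (Finset.univ : Finset K)
  rw [Finset.card_univ, ← hq, div_le_div_iff₀ (by positivity) (by positivity)] at hsz
  simp only [Fintype.piFinset_univ] at hsz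
  have hsz' : Finset.card {v : Fin m → K | eval v g = 0} * q ≤ g.totalDegree * q ^ m := by
    exact_mod_cast hsz
  have hsplit := Finset.card_filter_add_card_filter_not (s := (Finset.univ : Finset (Fin m → K)))
    (fun v ↦ eval v g = 0)
  simp only [Finset.card_univ, Fintype.card_pi, Finset.prod_const, Fintype.card_fin, ← hq] at hsplit
  simp only [← hg, ne_eq]
  calc _ = (Finset.card {v : Fin m → K | eval v g = 0} +
      Finset.card {v : Fin m → K | ¬ eval v g = 0}) * q + (q - 1) * q ^ m := by
        rw [hsplit, pow_succ]
    _ ≤ Finset.card {v : Fin m → K | ¬ eval v g = 0} * q +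
        (g.totalDegree + (q - 1)) * q ^ m := by
        rw [add_mul, add_mul]; omega
    _ ≤ _ := by gcongr

namespace PG

variable {n : ℕ} {K : Type*} [Field K]

theorem mem_projectivization_ker_iff (φ : Module.Dual K (Fin (n + 1) → K)) (P : PG n K) :
    P ∈ (LinearMap.ker φ).projectivization ↔ φ P.rep = 0 := by
  conv_lhs => rw [← P.mk_rep]
  rw [Submodule.mk_mem_projectivization_iff, LinearMap.mem_ker]

theorem isHyperplane_projectivization_ker {φ : Module.Dual K (Fin (n + 1) → K)} (hφ : φ ≠ 0) :
    IsHyperplane (LinearMap.ker φ).projectivization := by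
  have h := Module.Dual.finrank_ker_add_one_of_ne_zero hφ
  rw [Module.finrank_fin_fun] at h
  rw [IsHyperplane, OrderIso.apply_symm_apply]
  omega

theorem IsHyperplane.exists_eq_projectivization_ker
    {H : Projectivization.Subspace K (Fin (n + 1) → K)} (hH : IsHyperplane H) :
    ∃ φ : Module.Dual K (Fin (n + 1) → K), φ ≠ 0 ∧ H = (LinearMap.ker φ).projectivization := by
  have hlt : Projectivization.Subspace.submodule H < ⊤ := by
    refine Submodule.lt_top_of_finrank_lt_finrank ?_
    rw [hH, Module.finrank_fin_fun]
    omega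
  obtain ⟨φ, hφ, hle⟩ := Submodule.exists_le_ker_of_lt_top _ hlt
  refine ⟨φ, hφ, ?_⟩
  rw [OrderIso.eq_symm_apply]
  refine Submodule.eq_of_le_of_finrank_eq hle ?_
  have h := Module.Dual.finrank_ker_add_one_of_ne_zero hφ
  rw [Module.finrank_fin_fun] at h
  rw [hH]
  omega

/-- A linearly independent family in a finite-dimensional space extends to a basis by a family
indexed by `Fin m`, where `m` is the codimension of its span. -/
theorem _root_.LinearIndependent.exists_basis_sum_fin {V : Type*} [AddCommGroup V] [Module K V]
    [FiniteDimensional K V] {k m : ℕ} {v : Fin k → V} (hv : LinearIndependent K v)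
    (hm : Module.finrank K V = k + m) :
    ∃ b : Module.Basis (Fin k ⊕ Fin m) K V, ∀ i, b (Sum.inl i) = v i := by
  let b := Module.Basis.sumExtend hv
  have hb (i : Fin k) : b (Sum.inl i) = v i := by
    simp only [b, Module.Basis.sumExtend, Module.Basis.reindex_apply, Module.Basis.extend_apply_self]
    rfl
  have : Finite (Fin k ⊕ Module.Basis.sumExtendIndex hv) := Module.Finite.finite_basis b
  have : Finite (Module.Basis.sumExtendIndex hv) :=
    Finite.of_injective _ (Sum.inr_injective (α := Fin k))
  have hcard : Nat.card (Module.Basis.sumExtendIndex hv) = m := by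
    have h := Module.finrank_eq_nat_card_basis b
    rw [Nat.card_sum, Nat.card_fin] at h
    omega
  refine ⟨b.reindex (Equiv.sumCongr (Equiv.refl _) (Finite.equivFinOfCardEq hcard)), fun i ↦ ?_⟩
  simp [hb]

/-- Linearly independent forms vanishing at one of two distinct points, of which only the zeroth
does not vanish at the other point. -/
theorem exists_dual_family {m : ℕ} {P Q : PG (m + 1) K} (hPQ : Q ≠ P) :
    ∃ ψ : Fin (m + 1) → Module.Dual K (Fin (m + 1 + 1) → K), LinearIndependent K ψ ∧
      (∀ i, ψ i Q.rep = 0) ∧ ψ 0 P.rep = 1 ∧ ∀ i : Fin m, ψ i.succ P.rep = 0 := by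
  obtain ⟨b, hb⟩ :=
    (Projectivization.linearIndependent_pair_iff_ne.2 hPQ).exists_basis_sum_fin (m := m)
      (by rw [Module.finrank_fin_fun]; omega)
  have hQ : Q.rep = b (Sum.inl 0) := by simp [hb]
  have hP : P.rep = b (Sum.inl 1) := by simp [hb]
  -- Only the coordinate dual to `Q` is left out, so every chosen form vanishes at `Q`.
  let s : Fin (m + 1) → Fin 2 ⊕ Fin m := Fin.cons (Sum.inl 1) Sum.inr
  have hs : Function.Injective s := Fin.cons_injective_iff.2 ⟨by simp, Sum.inr_injective⟩
  refine ⟨fun i ↦ b.coord (s i), b.linearIndependent_coord.comp s hs, fun i ↦ ?_, ?_, fun i ↦ ?_⟩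
  · rw [hQ]
    refine Fin.cases ?_ (fun i ↦ ?_) i <;> simp [s]
  · simp [hP, s]
  · simp [hP, s]

theorem IsBlockingSet.exists_ne {B : Set (PG n K)} (hB : IsBlockingSet B) (P : PG n K) :
    ∃ Q ∈ B, Q ≠ P := by
  obtain ⟨φ, hφ⟩ := Module.Projective.exists_dual_ne_zero K P.rep_nonzero
  obtain ⟨Q, hQB, hQ⟩ :=
    hB _ (isHyperplane_projectivization_ker (φ := φ) fun h ↦ hφ (by simp [h]))
  rw [mem_projectivization_ker_iff] at hQ
  exact ⟨Q, hQB, fun h ↦ hφ (h ▸ hQ)⟩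

/-- Forms with equal kernels are proportional, and the common nonzero value at `y` fixes the scalar.
With `y` representing `Q`, distinct parameters give distinct hyperplanes. -/
theorem _root_.Module.Dual.eq_of_ker_eq {V : Type*} [AddCommGroup V] [Module K V]
    {f g : Module.Dual K V} (h : LinearMap.ker f = LinearMap.ker g) {y : V} (hy : f y ≠ 0)
    (hfg : f y = g y) : f = g := by
  ext x
  have hx : x - (f x / f y) • y ∈ LinearMap.ker f := by simp [hy]
  rw [h, LinearMap.mem_ker, map_sub, map_smul, ← hfg, smul_eq_mul, div_mul_cancel₀ _ hy,
    sub_eq_zero] at hx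
  exact hx.symm

/-- The polynomial in `u` whose value is the product of the values of `h + ∑ i, u i • ψ i` at a
finite set of points. -/
noncomputable def formProduct {m : ℕ} (h : Module.Dual K (Fin (n + 1) → K))
    (ψ : Fin m → Module.Dual K (Fin (n + 1) → K)) (S : Finset (PG n K)) : MvPolynomial (Fin m) K :=
  ∏ b ∈ S, (MvPolynomial.C (h b.rep) + ∑ i, MvPolynomial.C (ψ i b.rep) * MvPolynomial.X i)

theorem eval_formProduct {m : ℕ} (h : Module.Dual K (Fin (n + 1) → K))
    (ψ : Fin m → Module.Dual K (Fin (n + 1) → K)) (S : Finset (PG n K)) (u : Fin m → K) :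
    MvPolynomial.eval u (formProduct h ψ S) = ∏ b ∈ S, (h + ∑ i, u i • ψ i) b.rep := by
  simp [formProduct, LinearMap.sum_apply, mul_comm]

theorem totalDegree_formProduct_le {m : ℕ} (h : Module.Dual K (Fin (n + 1) → K))
    (ψ : Fin m → Module.Dual K (Fin (n + 1) → K)) (S : Finset (PG n K)) :
    (formProduct h ψ S).totalDegree ≤ S.card := by
  refine (MvPolynomial.totalDegree_finsetProd _ _).trans ?_
  rw [Finset.card_eq_sum_ones]
  refine Finset.sum_le_sum fun b _ ↦ (MvPolynomial.totalDegree_add _ _).trans (max_le (by simp) ?_)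
  refine MvPolynomial.totalDegree_finsetSum_le fun i _ ↦ (MvPolynomial.totalDegree_mul _ _).trans ?_
  simp

/-- A lower bound, in terms of the size of the blocking set, for the number of tangent hyperplanes
through an essential point. -/
theorem IsBlockingSet.card_tangentHyperplane [Fintype K] {m : ℕ} {B : Set (PG (m + 1) K)}
    (hB : IsBlockingSet B) {P : PG (m + 1) K} (hP : IsEssential B P) :
    Fintype.card K ^ (m + 1) + (Fintype.card K + 1) * Fintype.card K ^ m ≤
      {H : Projectivization.Subspace K (Fin (m + 1 + 1) → K) |
        IsTangentHyperplane B H ∧ P ∈ H}.ncard * Fintype.card K +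
      B.ncard * Fintype.card K ^ m := by
  classical
  obtain ⟨hPB, H, ⟨hH, hunique⟩, hPH⟩ := hP
  obtain ⟨h, -, rfl⟩ := hH.exists_eq_projectivization_ker
  have hne (b : PG (m + 1) K) (hb : b ∈ B) (hbP : b ≠ P) : h b.rep ≠ 0 := fun h0 ↦
    hbP (hunique.unique ⟨hb, (mem_projectivization_ker_iff h b).2 h0⟩ ⟨hPB, hPH⟩)
  rw [mem_projectivization_ker_iff] at hPH
  obtain ⟨Q, hQB, hQP⟩ := hB.exists_ne P
  obtain ⟨ψ, hψ, hψQ, hψ0, hψP⟩ := exists_dual_family hQP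
  have hfin : Finite (PG (m + 1) K) := inferInstance
  let T := B.toFinite.toFinset
  -- The factor of `Q` would be a nonzero constant and that of `P` would be `u 0`; dropping both
  -- saves 2 in the degree.
  let S := (T.erase P).erase Q
  have hS : S.card + 2 = B.ncard := by
    rw [Set.ncard_eq_toFinset_card B B.toFinite]
    have h1 : Q ∈ T.erase P := by simp [T, hQP, hQB]
    have h2 : P ∈ T := by simp [T, hPB]
    have := Finset.card_erase_add_one h1
    have := Finset.card_erase_add_one h2
    simp only [S, T] at *
    omega
  have hSmem (b : PG (m + 1) K) : b ∈ S ↔ b ≠ Q ∧ b ≠ P ∧ b ∈ B := by simp [S, T]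
  let φ (u : Fin (m + 1) → K) : Module.Dual K (Fin (m + 1 + 1) → K) := h + ∑ i, u i • ψ i
  have hφQ (u : Fin (m + 1) → K) : φ u Q.rep = h Q.rep := by
    simp [φ, LinearMap.sum_apply, hψQ]
  have hφP (u : Fin (m + 1) → K) : φ u P.rep = u 0 := by
    simp [φ, LinearMap.sum_apply, Fin.sum_univ_succ, hψ0, hψP, hPH]
  have hhQ := hne Q hQB hQP
  have hhyp (u : Fin (m + 1) → K) : IsHyperplane (LinearMap.ker (φ u)).projectivization :=
    isHyperplane_projectivization_ker fun h0 ↦ hhQ (by rw [← hφQ u, h0]; rfl)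
  have hinj : Function.Injective fun u ↦ (LinearMap.ker (φ u)).projectivization := by
    intro u v huv
    have h1 := Module.Dual.eq_of_ker_eq (Submodule.projectivization.injective huv)
      (y := Q.rep) (by rwa [hφQ]) (by rw [hφQ, hφQ])
    exact linearIndependent_iff_injective_fintypeLinearCombination.1 hψ (add_left_cancel h1)
  let f := formProduct h ψ S
  have hf (u : Fin (m + 1) → K) : MvPolynomial.eval u f = ∏ b ∈ S, φ u b.rep :=
    eval_formProduct h ψ S u
  have hf0 : MvPolynomial.eval 0 f ≠ 0 := by
    rw [hf, Finset.prod_ne_zero_iff]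
    intro b hb
    simpa [φ] using hne b ((hSmem b).1 hb).2.2 ((hSmem b).1 hb).2.1
  -- The hyperplane misses both `P` and `Q`, so the point of `B` blocking it lies in `S`.
  have hfz (u : Fin (m + 1) → K) (hu : u 0 ≠ 0) : MvPolynomial.eval u f = 0 := by
    obtain ⟨b, hbB, hb⟩ := hB _ (hhyp u)
    rw [mem_projectivization_ker_iff] at hb
    rw [hf]
    refine Finset.prod_eq_zero ((hSmem b).2 ⟨?_, ?_, hbB⟩) hb
    · rintro rfl
      exact hhQ (by rw [← hφQ u, hb])
    · rintro rfl
      exact hu (by rw [← hφP u, hb])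
  have hcount : Finset.card {v : Fin m → K |
      MvPolynomial.eval (Fin.cons 0 v : Fin (m + 1) → K) f ≠ 0} ≤
      {H : Projectivization.Subspace K (Fin (m + 1 + 1) → K) |
        IsTangentHyperplane B H ∧ P ∈ H}.ncard := by
    rw [← Set.ncard_coe_finset]
    have : Finite (Projectivization.Subspace K (Fin (m + 1 + 1) → K)) :=
      Finite.of_injective _ SetLike.coe_injective
    refine Set.ncard_le_ncard_of_injOn
      (fun v ↦ (LinearMap.ker (φ (Fin.cons 0 v))).projectivization) (fun v hv ↦ ?_)
      (fun v _ w _ hvw ↦ Fin.cons_right_injective (α := fun _ ↦ K) 0 (hinj hvw))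
    simp only [Finset.coe_filter, Finset.mem_univ, true_and, Set.mem_ofPred_eq, hf,
      Finset.prod_ne_zero_iff] at hv
    have hPm : P ∈ (LinearMap.ker (φ (Fin.cons 0 v))).projectivization := by
      rw [mem_projectivization_ker_iff, hφP, Fin.cons_zero]
    refine ⟨⟨hhyp _, P, ⟨hPB, hPm⟩, fun b ⟨hbB, hb⟩ ↦ ?_⟩, hPm⟩
    rw [mem_projectivization_ker_iff] at hb
    by_contra hbP
    refine hv b ((hSmem b).2 ⟨?_, hbP, hbB⟩) hb
    rintro rfl
    exact hhQ (by rw [← hφQ, hb])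
  have hmain := MvPolynomial.card_pow_le_of_eval_eq_zero f hf0 hfz
  have hdeg : f.totalDegree ≤ S.card := totalDegree_formProduct_le h ψ S
  have hqpos : 0 < Fintype.card K := Fintype.card_pos
  calc _ = Fintype.card K ^ (m + 1) + (Fintype.card K - 1) * Fintype.card K ^ m +
        2 * Fintype.card K ^ m := by
        rw [add_assoc, ← add_mul]; congr 2; omega
    _ ≤ _ := add_le_add_left hmain _
    _ ≤ _ := by
        rw [← hS, add_mul, ← add_assoc]
        gcongr

end PG

theorem theorem7 {K : Type*} [Field K] [Fintype K] (q : ℕ) (hq : Fintype.card K = q)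
    (n : ℕ) (hn : 2 ≤ n) (a : ℤ) (B : Set (PG n K)) (hB : PG.IsBlockingSet B)
    (hcard : (B.ncard : ℤ) = q + a + 1) (hle : B.ncard ≤ 2 * q)
    (P : PG n K) (hP : PG.IsEssential B P) :
    (q : ℤ) ^ (n - 1) - a * (q : ℤ) ^ (n - 2) ≤
      ({H : Projectivization.Subspace K (Fin (n + 1) → K) |
        PG.IsTangentHyperplane B H ∧ P ∈ H}.ncard : ℤ) := by
  obtain ⟨k, rfl⟩ : ∃ k, n = k + 1 + 1 := ⟨n - 2, by omega⟩
  have h := hB.card_tangentHyperplane hP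
  rw [hq] at h
  have hqpos : 0 < (q : ℤ) := by
    rw [← hq]
    exact_mod_cast Fintype.card_pos
  zify at h
  rw [hcard] at h
  rw [show k + 1 + 1 - 1 = k + 1 by omega, show k + 1 + 1 - 2 = k by omega]
  -- The counting bound carries an extra factor `q`, which avoids the exponent `m - 1`.
  refine le_of_mul_le_mul_right ?_ hqpos
  rw [pow_succ, pow_succ] at h
  rw [pow_succ]
  linarith
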